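/- Let $\lambda:[0,\infty)\to[0,\infty)$ be a continuous function, $\Lambda(t)=\int_0^t\lambda(u)\,du$, and let $N=(N_t)_{t\ge 0}$ be a non-homogeneous Poisson process with intensity $\lambda$ on a probability space: a counting process with $N_0=0$, independent increments, and $N_t-N_s$ Poisson distributed with mean $\Lambda(t)-\Lambda(s)$ for $0\le s\le t$. Let $\tau^*\ge 0$, and suppose that $\lambda(t)=m$ for every $t\ge\tau^*$. For $t>\tau^*$ put $\widehat m_t=(N_t-N_{\tau^*})/(t-\tau^*)$. Then the family $(\widehat m_t)_{t>\tau^*}$ is asymptotically normal with mean $m$ and variance $m/(t-\tau^*)$, that is, as $t\to\infty$, $$\sqrt{t-\tau^*}\,(\widehat m_t-m)\to \mathrm N(0,m)\quad\text{in distribution}$$ (where $\mathrm N(0,0)$ is the point mass at $0$), and, if $m>0$, $$\frac{\widehat m_t-m}{\sqrt{m/(t-\tau^*)}}\to \mathrm N(0,1)\quad\text{in distribution.}$$ -/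

import Mathlib

open MeasureTheory ProbabilityTheory Filter Topology
open scoped NNReal

/-- The cumulative intensity function `Λ(t) = ∫₀ᵗ λ(u) du` of an intensity `λ : ℝ₊ → ℝ₊`. -/
noncomputable def cumulativeIntensity (lam : ℝ≥0 → ℝ≥0) (t : ℝ≥0) : ℝ :=
  ∫ u in (0 : ℝ)..(t : ℝ), (lam u.toNNReal : ℝ)

/-- `N = (N_t)_{t ≥ 0}` is a non-homogeneous Poisson process with intensity function `lam` under
`P`: it is a counting process (almost surely it starts at zero and has nondecreasing
right-continuous `ℕ`-valued paths), it has independent increments, and for `s ≤ t` the increment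
`N_t - N_s` has the Poisson law with mean `Λ(t) - Λ(s)`. -/
structure IsPoissonProcess {Ω : Type*} [MeasurableSpace Ω] (N : ℝ≥0 → Ω → ℕ) (lam : ℝ≥0 → ℝ≥0)
    (P : Measure Ω) : Prop where
  measurable : ∀ t, Measurable (N t)
  start_zero : ∀ᵐ ω ∂P, N 0 ω = 0
  monotone_path : ∀ᵐ ω ∂P, Monotone fun t => N t ω
  rightContinuous_path : ∀ᵐ ω ∂P, ∀ t, ContinuousWithinAt (fun s => N s ω) (Set.Ici t) t
  indep_increments : HasIndepIncrements (fun t ω => (N t ω : ℝ)) P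
  increment_law : ∀ s t, s ≤ t →
    HasLaw (fun ω => (N t ω : ℝ) - (N s ω : ℝ))
      ((poissonMeasure (cumulativeIntensity lam t - cumulativeIntensity lam s).toNNReal).map
        (fun n : ℕ => (n : ℝ))) P

/-- The estimator `(N_t - N_τ) / (t - τ)`, used for `t > τ`. -/
noncomputable def slopeEstimator {Ω : Type*} (N : ℝ≥0 → Ω → ℕ) (τ t : ℝ≥0) (ω : Ω) : ℝ :=
  ((N t ω : ℝ) - (N τ ω : ℝ)) / ((t : ℝ) - (τ : ℝ))

/-! After `τ` the rate is constant, so `N t - N τ` is a single Poisson variable of rate `r = m (t -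
τ)`, and both statistics have the form `c (X - r)` with `c → 0` and `c² r` equal to the limit
variance `v`. The characteristic exponent `r (e^{icu} - 1 - icu)` then tends to `-v u² / 2`, and
Lévy's continuity theorem concludes. Only one-time increment laws enter. -/

/-- The centred and rescaled Poisson variable
`c * (X - r)` with `X` of rate `r` has characteristic function `exp (r (e^{icu} - 1 - icu))`. -/
theorem charFun_const_mul_sub_of_hasLaw_poisson {Ω : Type*} [MeasurableSpace Ω] {P : Measure Ω}
    {X : Ω → ℝ} {r : ℝ≥0}
    (hX : HasLaw X ((poissonMeasure r).map (fun n : ℕ => (n : ℝ))) P) (c u : ℝ) :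
    charFun (P.map fun ω => c * (X ω - r)) u =
      Complex.exp (r * (Complex.exp ((c * u : ℝ) * Complex.I) - 1 - (c * u : ℝ) * Complex.I)) := by
  have hX' := hX.aemeasurable
  have hshift : P.map (fun ω => X ω - r) = (P.map X).map (· + (-(r : ℝ))) := by
    rw [AEMeasurable.map_map_of_aemeasurable (by fun_prop) hX']
    rfl
  rw [charFun_map_mul_comp (by fun_prop), hshift, charFun_map_add_const, hX.map_eq,
    charFun_map_cast_poissonMeasure, ← Complex.exp_add]
  congr 1
  simp only [Real.inner_apply]
  push_cast
  ring

/-- Second order expansion of the characteristic exponent of a rescaled centred Poisson variable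
with variance `v`, as the scale `c` tends to zero. -/
theorem tendsto_poisson_charExponent {ι : Type*} {l : Filter ι} {r c : ι → ℝ} {v : ℝ}
    (hc : Tendsto c l (𝓝 0)) (hv : ∀ i, c i ^ 2 * r i = v) (u : ℝ) :
    Tendsto (fun i => (r i : ℂ) *
      (Complex.exp ((c i * u : ℝ) * Complex.I) - 1 - (c i * u : ℝ) * Complex.I)) l
      (𝓝 (-(v * u ^ 2 / 2 : ℂ))) := by
  rw [tendsto_iff_norm_sub_tendsto_zero]
  -- The cubic Taylor remainder times `r` has size `|r| |c u|³ e^{|c u|}`; as `c² r = v`, one factor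
  -- `|c|` is left over.
  have hbound : Tendsto (fun i => |v| * |u| ^ 3 * |c i| * Real.exp (|c i * u|)) l (𝓝 0) := by
    have h : Continuous fun x : ℝ => |v| * |u| ^ 3 * |x| * Real.exp (|x * u|) := by fun_prop
    simpa [Function.comp_def] using (h.tendsto 0).comp hc
  refine squeeze_zero (fun _ => norm_nonneg _) (fun i => ?_) hbound
  have h3 := Complex.norm_exp_sub_sum_le_norm_mul_exp ((c i * u : ℝ) * Complex.I) 3
  have hnorm : ‖((c i * u : ℝ) : ℂ) * Complex.I‖ = |c i * u| := by simp
  rw [hnorm] at h3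
  -- The quadratic Taylor term `r (icu)² / 2` is exactly the limit, so the difference is `r` times
  -- the remainder.
  have hsum : (r i : ℂ) *
      (Complex.exp ((c i * u : ℝ) * Complex.I) - 1 - (c i * u : ℝ) * Complex.I) -
        -(v * u ^ 2 / 2 : ℂ) = r i * (Complex.exp ((c i * u : ℝ) * Complex.I) -
      ∑ k ∈ Finset.range 3, ((c i * u : ℝ) * Complex.I) ^ k / (k.factorial : ℂ)) := by
    rw [← hv i]
    simp only [Finset.sum_range_succ, Finset.sum_range_zero, Nat.factorial, mul_pow, Complex.I_sq]
    push_cast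
    ring
  rw [hsum, norm_mul, Complex.norm_real, Real.norm_eq_abs]
  calc |r i| * _ ≤ |r i| * (|c i * u| ^ 3 * Real.exp |c i * u|) := by gcongr
    _ = |v| * |u| ^ 3 * |c i| * Real.exp (|c i * u|) := by
      rw [← hv i, abs_mul, abs_mul, abs_pow]
      ring

/-- The normal approximation of the Poisson distribution: if `X i` is Poisson of rate `r i` and the
scales `c i` tend to zero in such a way that `c i * (X i - r i)` has constant variance `v`, then
`c i * (X i - r i)` converges in distribution to `N(0, v)`. -/
theorem tendstoInDistribution_const_mul_sub_of_hasLaw_poisson {ι Ω : Type*} [MeasurableSpace Ω]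
    {P : Measure Ω} [IsProbabilityMeasure P] {l : Filter ι} [l.IsCountablyGenerated]
    {X : ι → Ω → ℝ} {r : ι → ℝ≥0} {c : ι → ℝ} {v : ℝ≥0}
    (hX : ∀ i, HasLaw (X i) ((poissonMeasure (r i)).map (fun n : ℕ => (n : ℝ))) P)
    (hc : Tendsto c l (𝓝 0)) (hv : ∀ i, c i ^ 2 * r i = v) :
    TendstoInDistribution (fun i ω => c i * (X i ω - r i)) l (id : ℝ → ℝ) (fun _ => P)
      (gaussianReal 0 v) where
  forall_aemeasurable i := ((hX i).aemeasurable.sub_const _).const_mul _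
  aemeasurable_limit := aemeasurable_id
  tendsto := by
    -- Passing to sequences, where Lévy's theorem applies, uses that `l` is countably generated.
    refine tendsto_of_seq_tendsto fun s hs => ?_
    refine ProbabilityMeasure.tendsto_iff_tendsto_charFun.2 fun u => ?_
    change Tendsto (fun n => charFun (P.map fun ω => c (s n) * (X (s n) ω - r (s n))) u) atTop
      (𝓝 (charFun ((gaussianReal 0 v).map id) u))
    have h := (tendsto_poisson_charExponent (hc.comp hs) (fun n => hv (s n)) u).cexp
    simpa only [charFun_const_mul_sub_of_hasLaw_poisson (hX _), Measure.map_id,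
      charFun_gaussianReal, Function.comp_apply, Complex.ofReal_zero, mul_zero, zero_mul, zero_sub] using h

/-- After the time `τ` from which the intensity is constant, the cumulative intensity grows
linearly. -/
theorem cumulativeIntensity_sub_of_eq_const {lam : ℝ≥0 → ℝ≥0} (hlam : Continuous lam)
    {τ m : ℝ≥0} (hm : ∀ t, τ ≤ t → lam t = m) {t : ℝ≥0} (ht : τ ≤ t) :
    cumulativeIntensity lam t - cumulativeIntensity lam τ = m * ((t : ℝ) - τ) := by
  have hcont : Continuous fun u : ℝ => (lam u.toNNReal : ℝ) := by fun_prop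
  rw [cumulativeIntensity, cumulativeIntensity, intervalIntegral.integral_interval_sub_left
    (hcont.intervalIntegrable _ _) (hcont.intervalIntegrable _ _)]
  have hcongr : ∫ u in (τ : ℝ)..t, (lam u.toNNReal : ℝ) = ∫ _ in (τ : ℝ)..t, (m : ℝ) := by
    refine intervalIntegral.integral_congr fun u hu => ?_
    rw [Set.uIcc_of_le (NNReal.coe_le_coe.2 ht)] at hu
    rw [hm _ (NNReal.le_toNNReal_of_coe_le hu.1)]
  rw [hcongr, intervalIntegral.integral_const, smul_eq_mul, mul_comm]

/-- The increments after `τ` are Poisson with mean proportional to the elapsed time. -/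
theorem IsPoissonProcess.hasLaw_sub_of_eq_const {Ω : Type*} [MeasurableSpace Ω] {P : Measure Ω}
    {lam : ℝ≥0 → ℝ≥0} (hlam : Continuous lam) {N : ℝ≥0 → Ω → ℕ} (hN : IsPoissonProcess N lam P)
    {τ m : ℝ≥0} (hm : ∀ t, τ ≤ t → lam t = m) {t : ℝ≥0} (ht : τ ≤ t) :
    HasLaw (fun ω => (N t ω : ℝ) - (N τ ω : ℝ))
      ((poissonMeasure (m * (t - τ))).map (fun n : ℕ => (n : ℝ))) P := by
  have h := hN.increment_law τ t ht
  rwa [cumulativeIntensity_sub_of_eq_const hlam hm ht, ← NNReal.coe_sub ht, ← NNReal.coe_mul,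
    Real.toNNReal_coe] at h

/-- The inverse square root of the elapsed time, suitably normalised, vanishes as time grows. -/
theorem tendsto_inv_sqrt_mul_elapsed (τ : ℝ≥0) {k : ℝ} (hk : 0 < k) :
    Tendsto (fun t : Set.Ioi τ => (√(k * (((t : ℝ≥0) : ℝ) - τ)))⁻¹) atTop (𝓝 0) := by
  have hcoe : Tendsto (fun t : Set.Ioi τ => (t : ℝ≥0)) atTop atTop := by
    rw [atTop_Ioi_eq]
    exact tendsto_comap
  have hsub : Tendsto (fun t : Set.Ioi τ => ((t : ℝ≥0) : ℝ) - τ) atTop atTop :=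
    tendsto_atTop_add_const_right _ _ (NNReal.tendsto_coe_atTop.2 hcoe)
  exact (Real.tendsto_sqrt_atTop.comp (hsub.const_mul_atTop hk)).inv_tendsto_atTop

theorem corollary2 {Ω : Type*} [MeasurableSpace Ω] (P : Measure Ω) [IsProbabilityMeasure P]
    (lam : ℝ≥0 → ℝ≥0) (hlam : Continuous lam) (N : ℝ≥0 → Ω → ℕ)
    (hN : IsPoissonProcess N lam P) (τ m : ℝ≥0) (hm : ∀ t, τ ≤ t → lam t = m) :
    TendstoInDistribution
      (fun (t : Set.Ioi τ) ω =>
        √(((t : ℝ≥0) : ℝ) - (τ : ℝ)) * (slopeEstimator N τ t ω - (m : ℝ)))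
      atTop (id : ℝ → ℝ) (fun _ => P) (gaussianReal 0 m) ∧
    (0 < m → TendstoInDistribution
      (fun (t : Set.Ioi τ) ω =>
        (slopeEstimator N τ t ω - (m : ℝ)) / √((m : ℝ) / (((t : ℝ≥0) : ℝ) - (τ : ℝ))))
      atTop (id : ℝ → ℝ) (fun _ => P) (gaussianReal 0 1)) := by
  have hcg : (atTop : Filter (Set.Ioi τ)).IsCountablyGenerated := by
    rw [atTop_Ioi_eq]
    infer_instance
  have hlaw (t : Set.Ioi τ) := hN.hasLaw_sub_of_eq_const hlam hm t.2.le
  have hpos (t : Set.Ioi τ) : 0 < ((t : ℝ≥0) : ℝ) - τ := sub_pos.2 (NNReal.coe_lt_coe.2 t.2)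
  have hrate (t : Set.Ioi τ) : ((m * (t - τ) : ℝ≥0) : ℝ) = m * (((t : ℝ≥0) : ℝ) - τ) := by
    rw [NNReal.coe_mul, NNReal.coe_sub t.2.le]
  refine ⟨?_, fun hm0 => ?_⟩
  -- Scale `c = 1 / √(t - τ)`, so `c² r = m`; this includes `m = 0`.
  · have h := tendstoInDistribution_const_mul_sub_of_hasLaw_poisson (v := m) hlaw
      (tendsto_inv_sqrt_mul_elapsed τ one_pos) fun t => by
        have := (hpos t).ne'
        rw [hrate, inv_pow, one_mul, Real.sq_sqrt (hpos t).le]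
        field_simp
    convert h using 3 with t ω
    have hd := hpos t
    rw [hrate, slopeEstimator, one_mul, inv_mul_eq_div, eq_div_iff (Real.sqrt_pos.2 hd).ne']
    rw [mul_right_comm, Real.mul_self_sqrt hd.le]
    field_simp
  · have hm' : (0 : ℝ) < m := hm0
    -- Scale `c = 1 / √(m (t - τ))`, so `c² r = 1`.
    have h := tendstoInDistribution_const_mul_sub_of_hasLaw_poisson (v := 1) hlaw
      (tendsto_inv_sqrt_mul_elapsed τ hm') fun t => by
        have := (hpos t).ne'
        rw [hrate, inv_pow, Real.sq_sqrt (mul_pos hm' (hpos t)).le, NNReal.coe_one]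
        field_simp
    convert h using 3 with t ω
    have hd := hpos t
    have hsd := Real.sqrt_pos.2 hd
    have hsm := Real.sqrt_pos.2 hm'
    rw [hrate, slopeEstimator, Real.sqrt_div hm'.le, Real.sqrt_mul hm'.le]
    field_simp
    rw [Real.sq_sqrt hd.le]
    ring
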